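/- A \emph{graph} here is a finite directed simple graph $G$ with at least one vertex: a finite nonempty vertex set $V$ and an edge set $E\subseteq V\times V$ containing no loop $ii$. A \emph{path} from $i$ to $j$ is a nonempty sequence of edges $ii_1, i_1i_2,\ldots,i_{k-1}i_k,i_kj$ ($k\ge 0$) whose intermediate vertices $i_1,\ldots,i_k$ are distinct from each other and from $i,j$; it is a \emph{cycle} if $i=j$. $G$ is \emph{connected} if there is a path from $i$ to $j$ for all vertices $i\ne j$. A \emph{state} of $G$ is a matrix $b=(b_{ij})_{i,j\in V}$ of reals with $b_{ij}>0$ if $ij\in E$ and $b_{ij}=0$ otherwise. If $G$ is connected then for each state $b$ there is a vector $p=p(b)$ with $p_i>0$ for all $i$, unique up to a positive scalar, such that $\sum_i p_i b_{ij}=\sum_i p_j b_{ji}$ for all $j\in V$; so the ratios $p_i/p_j$ are functions of $b$. Let $\pi_{ij}(G)$ be the number of pairs $kl$ for which there are two states of $G$ that differ only in the $kl$ entry and have different ratios $p_i/p_j$. The \emph{price complexity} of $G$ is $\pi(G)=\max_{i\neq j}\pi_{ij}(G)$, with $\pi(G)=0$ if $G$ is a single vertex. A \emph{chorded cycle} is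 a graph that is a union $C\cup P$ of a cycle $C$ and a path $P$ which connects two distinct vertices of $C$ and is otherwise disjoint from $C$ (no common edge, and no common vertex except the endpoints of $P$). For $k\ge 0$, a \emph{$k$-rose} is a graph that is a union $C_1\cup\cdots\cup C_k$ of cycles that share a single vertex but are otherwise disjoint; thus a $0$-rose is a single vertex and a $1$-rose is a cycle. \textbf{Theorem.} Let $G$ be a connected graph. If $G$ is neither a chorded cycle nor a $k$-rose for any $k\ge 0$, then $\pi(G)\ge 5$. Moreover, $\pi(G)=0$ if $G$ is a single vertex, $\pi(G)=2$ if $G$ is a cycle, and $\pi(G)=4$ if $G$ is a chorded cycle or a $k$-rose with $k\geq 2$. Consequently $\pi(G)\le 4$ if and only if $G$ is a chorded cycle or a $k$-rose for some $k\ge 0$. -/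

import Mathlib

/-!
A graph is a `Digraph V` on a finite vertex type `V` without loops; the looplessness is the
predicate `IsSimple`. Weights are matrices `b : V → V → ℝ`.
-/

namespace PriceComplexity

variable {V : Type*}

/-! ### Directed graphs, paths and cycles -/

/-- A directed simple graph has no loops (double edges are excluded by `Digraph`). -/
def IsSimple (G : Digraph V) : Prop := ∀ v, ¬ G.Adj v v

/-- The consecutive edges `i l₁, l₁ l₂, …, lₖ j` of the path from `i` to `j` with list of
intermediate vertices `l = [l₁, …, lₖ]`. -/
def pathEdges (i j : V) (l : List V) : List (V × V) := (i :: l).zip (l ++ [j])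

/-- `i l₁ … lₖ j` is a path of `G` from `i` to `j`: a nonempty sequence of consecutive edges whose
intermediate vertices are distinct from each other and from the endpoints. The endpoints may
coincide. -/
structure IsPath (G : Digraph V) (i j : V) (l : List V) : Prop where
  adj : ∀ e ∈ pathEdges i j l, G.Adj e.1 e.2
  nodup : l.Nodup
  left_notMem : i ∉ l
  right_notMem : j ∉ l

/-- A cycle of `G` through `i`, written with `i` as its base point: a path from `i` to itself.
Its vertices are `i` and the elements of `l`. -/
def IsCycleAt (G : Digraph V) (i : V) (l : List V) : Prop := IsPath G i i l

/-- `G` is connected: there is a (directed) path from any vertex to any other vertex. -/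
def IsConnected (G : Digraph V) : Prop := ∀ i j : V, i ≠ j → ∃ l, IsPath G i j l

/-! ### Roses and chorded cycles -/

/-- `G` is a `k`-rose: the union `C₁ ∪ ⋯ ∪ Cₖ` of `k` cycles sharing a single vertex `j` and
otherwise disjoint. For `k = 0` this is a single vertex, for `k = 1` it is a cycle. -/
def IsRose (k : ℕ) (G : Digraph V) : Prop :=
  ∃ (j : V) (C : Fin k → List V),
    (∀ s, IsCycleAt G j (C s)) ∧
    (∀ s t, s ≠ t → (C s).Disjoint (C t)) ∧
    (∀ v, v = j ∨ ∃ s, v ∈ C s) ∧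
    (∀ u v, G.Adj u v ↔ ∃ s, (u, v) ∈ pathEdges j j (C s))

/-- `G` is a chorded cycle: the union `C ∪ P` of a cycle `C` and a path `P` which connects two
distinct vertices `i`, `x` of `C` and is otherwise disjoint from `C` (in vertices and in edges).
The base point of `C` is taken to be the initial vertex `i` of `P`, so that the vertices of `C`
other than `i` are the elements of `c`. -/
def IsChordedCycle (G : Digraph V) : Prop :=
  ∃ (i x : V) (c p : List V),
    IsCycleAt G i c ∧
    x ∈ c ∧
    IsPath G i x p ∧
    c.Disjoint p ∧
    (pathEdges i i c).Disjoint (pathEdges i x p) ∧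
    (∀ v, v = i ∨ v ∈ c ∨ v ∈ p) ∧
    (∀ u v, G.Adj u v ↔ (u, v) ∈ pathEdges i i c ∨ (u, v) ∈ pathEdges i x p)

/-! ### Prices and price complexity -/

/-- The states of the mechanism of `G`: aggregate offers, positive on every edge of `G` and zero
off the edges. -/
def states (G : Digraph V) : Set (V → V → ℝ) :=
  {b | ∀ i j, (G.Adj i j → 0 < b i j) ∧ (¬ G.Adj i j → b i j = 0)}

/-- `p` is a price vector at the state `b`: it is strictly positive and satisfies value
conservation, `∑ᵢ pᵢ bᵢⱼ = ∑ᵢ pⱼ bⱼᵢ` for every `j`. -/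
def IsPriceVector [Fintype V] (b : V → V → ℝ) (p : V → ℝ) : Prop :=
  (∀ i, 0 < p i) ∧ ∀ j, ∑ i, p i * b i j = ∑ i, p j * b j i

/-- A representative of the ray of price vectors at the state `b`. (At a state of a connected graph
there is exactly one such ray.) -/
noncomputable def price [Fintype V] (b : V → V → ℝ) : V → ℝ :=
  Classical.epsilon (IsPriceVector b)

/-- The price ratio `pᵢ / pⱼ` as a function of the state. It does not depend on the representative
chosen in `price`. -/
noncomputable def priceRatio [Fintype V] (i j : V) (b : V → V → ℝ) : ℝ :=
  price b i / price b j

/-- The component `kl` of the state is influential for `f` if there are two states of `G`, differing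
only in that component, at which `f` takes different values. -/
def IsInfluential (G : Digraph V) (f : (V → V → ℝ) → ℝ) (kl : V × V) : Prop :=
  ∃ b ∈ states G, ∃ b' ∈ states G,
    (∀ i j, (i, j) ≠ kl → b i j = b' i j) ∧ f b ≠ f b'

/-- `π_ij(G)`, the number of influential components in the price ratio `pᵢ / pⱼ`. -/
noncomputable def pairPriceComplexity [Fintype V] (G : Digraph V) (i j : V) : ℕ :=
  {kl : V × V | IsInfluential G (priceRatio i j) kl}.ncard

/-- The price complexity `π(G)`, the maximum of `π_ij(G)` over `i ≠ j`; it is `0` if there is only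
one vertex. -/
noncomputable def priceComplexity [Fintype V] [DecidableEq V] (G : Digraph V) : ℕ :=
  (Finset.univ : Finset V).offDiag.sup fun e => pairPriceComplexity G e.1 e.2

end PriceComplexity

/-!
For two vertices `i ≠ j` and a state `b`, consider the Markov chain with jump rates `b` and the
probability `h` of hitting `i` before `j`, a function harmonic off `{i, j}`. A price vector `p` is
an invariant measure of the chain, so pairing `p` with the generator applied to `h` gives one
linear relation between `pᵢ` and `pⱼ`, and changing `b` in the component `kl` changes this
relation by a multiple of `h l - h k`. Hence an edge `kl` is influential for `pᵢ / pⱼ` exactly if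
`h k ≠ h l` at some state (`isInfluential_of_harmonic`, `IsInfluential.exists_harmonic`).

With maximum principles this gives three combinatorial criteria: an edge `ki` is influential if
`k` reaches `j` avoiding `i` (`isInfluential_of_adj_left`); so is an edge `il` if `l` reaches `j`
avoiding `i` (`isInfluential_of_left_adj`); and if `ki` is an edge, so is `kl` if `l` reaches `j`
avoiding `k` and `i` (`isInfluential_of_fork`).

Lower bounds. Every pair has an influential edge out of either vertex, which gives two. If `su`
and `sv` are edges, the pair `u`, `v` has four influential edges. If two vertices have outdegree
at least two, there are five (`five_le_priceComplexity_of_two_forks`). Otherwise all vertices but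
one, `s`, have outdegree one, and the graph is the union of the cycles through the edges out of
`s`. If these are disjoint apart from `s`, it is a rose. If two of them meet and there is no
third, it is a chorded cycle (`isChordedCycle_of_merge`), and if there is a third, there are again
five influential edges (`five_le_priceComplexity_of_merge`).

Upper bounds. Harmonicity forces `h k = h l` along an edge `kl` if `k` differs from `i` and `j`
and has outdegree one, so that only edges out of `i`, `j` and the vertex `s` of larger outdegree
count; in a rose, `h` is moreover constant on the cycles that contain neither `i` nor `j`.
-/

namespace PriceComplexity

variable {V : Type*}

/-! ### Walks avoiding a set -/

/-- `Reach G S x y`: there is a walk in `G`, possibly without edges, from `x` to `y` all of whose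
vertices, endpoints included, lie outside `S`. -/
inductive Reach (G : Digraph V) (S : Set V) : V → V → Prop
  | refl {x : V} : x ∉ S → Reach G S x x
  | step {x z y : V} : x ∉ S → G.Adj x z → Reach G S z y → Reach G S x y

namespace Reach

variable {G : Digraph V} {S T : Set V} {x y z : V}

theorem left_notMem (h : Reach G S x y) : x ∉ S := by
  cases h <;> assumption

theorem right_notMem (h : Reach G S x y) : y ∉ S := by
  induction h with
  | refl h => exact h
  | step _ _ _ ih => exact ih

theorem trans (h : Reach G S x y) (h' : Reach G S y z) : Reach G S x z := by
  induction h with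
  | refl _ => exact h'
  | step hx hadj _ ih => exact .step hx hadj (ih h')

theorem mono (h : Reach G S x y) (hTS : T ⊆ S) : Reach G T x y := by
  induction h with
  | refl h => exact .refl fun hx => h (hTS hx)
  | step hx hadj _ ih => exact .step (fun h => hx (hTS h)) hadj ih

theorem tail (h : Reach G S x y) (hadj : G.Adj y z) (hz : z ∉ S) : Reach G S x z :=
  h.trans (.step h.right_notMem hadj (.refl hz))

/-- A walk either avoids `w` or can be cut off at `w`. -/
theorem insert_or (h : Reach G S x y) (w : V) : Reach G (insert w S) x y ∨ Reach G S x w := by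
  induction h with
  | @refl x hx =>
    by_cases hxw : x = w
    · exact .inr (hxw ▸ .refl hx)
    · exact .inl (.refl (by simp [hxw, hx]))
  | @step x z y hx hadj _ ih =>
    by_cases hxw : x = w
    · exact .inr (hxw ▸ .refl hx)
    · exact ih.imp (.step (by simp [hxw, hx]) hadj) (.step hx hadj)

/-- If `x` reaches `y`, then one of the two vertices `x ≠ w` reaches `y` without meeting the other:
cut a walk after its last visit to `{x, w}`. -/
theorem insert_or_insert {w : V} (h : Reach G S x y) (hxw : x ≠ w) :
    Reach G (insert w S) x y ∨ Reach G (insert x S) w y := by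
  have key : ∀ v, Reach G S v y →
      Reach G (insert x (insert w S)) v y ∨
        Reach G (insert w S) x y ∨ Reach G (insert x S) w y := by
    intro v hv
    induction hv with
    | @refl v hv =>
      by_cases h1 : v = x
      · subst h1; exact .inr (.inl (.refl (by simp [hxw, hv])))
      by_cases h2 : v = w
      · subst h2; exact .inr (.inr (.refl (by simp [hxw.symm, hv])))
      exact .inl (.refl (by simp [h1, h2, hv]))
    | @step v z y hv hadj _ ih =>
      rcases ih h with ih | ih
      · by_cases h1 : v = x
        · subst h1
          exact .inr (.inl (.step (by simp [hxw, hv]) hadj (ih.mono (Set.subset_insert _ _))))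
        by_cases h2 : v = w
        · subst h2
          exact .inr (.inr (.step (by simp [hxw.symm, hv]) hadj
            (ih.mono (Set.insert_subset_insert (Set.subset_insert _ _)))))
        exact .inl (.step (by simp [h1, h2, hv]) hadj ih)
      · exact .inr ih
  rcases key x h with h' | h'
  · exact absurd (Set.mem_insert _ _) h'.left_notMem
  · exact h'

end Reach

/-! ### Edges of paths -/

theorem pathEdges_cons (i j v : V) (l : List V) :
    pathEdges i j (v :: l) = (i, v) :: pathEdges v j l := rfl

theorem pathEdges_append (i j z : V) (l r : List V) :
    pathEdges i j (l ++ z :: r) = pathEdges i z l ++ pathEdges z j r := by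
  induction l generalizing i with
  | nil => rfl
  | cons v l ih => simp [pathEdges_cons, ih]

theorem mem_of_mem_pathEdges {i j x y : V} {l : List V} (h : (x, y) ∈ pathEdges i j l) :
    x ∈ i :: l :=
  (List.of_mem_zip h).1

theorem exists_mem_pathEdges {i x : V} (j : V) {l : List V} (h : x ∈ i :: l) :
    ∃ y, (x, y) ∈ pathEdges i j l ∧ (y ∈ l ∨ y = j) := by
  induction l generalizing i with
  | nil => exact ⟨j, by simpa [pathEdges] using h, .inr rfl⟩
  | cons v l ih =>
    rcases List.mem_cons.1 h with rfl | h
    · exact ⟨v, by simp [pathEdges_cons], by simp⟩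
    · obtain ⟨y, hy, hy'⟩ := ih h
      exact ⟨y, by simp [pathEdges_cons, hy], by rcases hy' with h | h <;> simp [h]⟩

theorem pathEdges_right_unique {i j x y z : V} {l : List V} (hl : (i :: l).Nodup)
    (hy : (x, y) ∈ pathEdges i j l) (hz : (x, z) ∈ pathEdges i j l) : y = z := by
  induction l generalizing i with
  | nil => simp_all [pathEdges]
  | cons v l ih =>
    rw [List.nodup_cons] at hl
    rw [pathEdges_cons, List.mem_cons, Prod.mk.injEq] at hy hz
    rcases hy with ⟨rfl, rfl⟩ | hy <;> rcases hz with ⟨h, rfl⟩ | hz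
    · rfl
    · exact absurd (mem_of_mem_pathEdges hz) hl.1
    · exact absurd (h ▸ mem_of_mem_pathEdges hy) hl.1
    · exact ih hl.2 hy hz

namespace IsPath

variable {G : Digraph V} {i j z : V} {l r : List V} {S : Set V}

theorem nodup_cons (h : IsPath G i j l) : (i :: l).Nodup :=
  List.nodup_cons.2 ⟨h.left_notMem, h.nodup⟩

theorem adj_head (h : IsPath G i j (z :: l)) : G.Adj i z :=
  h.adj (i, z) (by simp [pathEdges_cons])

theorem tail (h : IsPath G i j (z :: l)) : IsPath G z j l where
  adj e he := h.adj e (by simp [pathEdges_cons, he])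
  nodup := (List.nodup_cons.1 h.nodup).2
  left_notMem := (List.nodup_cons.1 h.nodup).1
  right_notMem hj := h.right_notMem (by simp [hj])

theorem cons (h : IsPath G z j l) (hadj : G.Adj i z) (hi : i ∉ z :: l) (hj : j ≠ z) :
    IsPath G i j (z :: l) where
  adj e he := by
    rcases List.mem_cons.1 (pathEdges_cons i j z l ▸ he) with rfl | he
    · exact hadj
    · exact h.adj e he
  nodup := h.nodup_cons
  left_notMem := hi
  right_notMem := by simp [hj, h.right_notMem]

theorem left_of_append (h : IsPath G i j (l ++ z :: r)) : IsPath G i z l where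
  adj e he := h.adj e (by rw [pathEdges_append]; exact List.mem_append_left _ he)
  nodup := h.nodup.of_append_left
  left_notMem hi := h.left_notMem (by simp [hi])
  right_notMem hz := (List.nodup_append.1 h.nodup).2.2 z hz z (by simp) rfl

theorem reach (h : IsPath G i j l) (hS : ∀ v ∈ i :: l, v ∉ S) (hj : j ∉ S) : Reach G S i j := by
  induction l generalizing i with
  | nil => exact .step (hS i (by simp)) (h.adj (i, j) (by simp [pathEdges])) (.refl hj)
  | cons v l ih =>
    exact .step (hS i (by simp)) h.adj_head
      (ih h.tail fun w hw => hS w (List.mem_cons_of_mem _ hw))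

theorem reach_mem (h : IsPath G i j l) (hS : ∀ v ∈ i :: l, v ∉ S) (hz : z ∈ i :: l) :
    Reach G S i z := by
  induction l generalizing i with
  | nil =>
    obtain rfl : z = i := by simpa using hz
    exact .refl (hS z (by simp))
  | cons v l ih =>
    rcases List.mem_cons.1 hz with rfl | hz
    · exact .refl (hS z (by simp))
    · exact .step (hS i (by simp)) h.adj_head
        (ih h.tail (fun w hw => hS w (List.mem_cons_of_mem _ hw)) hz)

end IsPath

theorem IsSimple.ne_of_adj {G : Digraph V} (hs : IsSimple G) {x y : V} (h : G.Adj x y) : x ≠ y := by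
  rintro rfl
  exact hs _ h

theorem IsConnected.reach {G : Digraph V} (hG : IsConnected G) (x y : V) : Reach G ∅ x y := by
  by_cases h : x = y
  · exact h ▸ .refl (by simp)
  · obtain ⟨l, hl⟩ := hG x y h
    exact hl.reach (by simp) (by simp)

/-- A path out of `x` does not return to `x`. -/
theorem IsConnected.exists_adj_reach {G : Digraph V} (hG : IsConnected G) {x y : V} (h : x ≠ y) :
    ∃ z, G.Adj x z ∧ Reach G {x} z y := by
  obtain ⟨l, hl⟩ := hG x y h
  cases l with
  | nil => exact ⟨y, hl.adj (x, y) (by simp [pathEdges]), .refl (by simpa using h.symm)⟩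
  | cons z l =>
    refine ⟨z, hl.adj_head, hl.tail.reach (fun v hv => ?_) (by simpa using h.symm)⟩
    rintro rfl
    exact hl.left_notMem hv

/-- Of two edges out of `s`, one may be chosen that leads to `t` without meeting the head of the
other. -/
theorem IsConnected.exists_adj_reach_insert {G : Digraph V} {s t x y : V}
    (hG : IsConnected G) (hst : s ≠ t) (hx : G.Adj s x)
    (hy : G.Adj s y) (hxy : x ≠ y) :
    ∃ u v, G.Adj s u ∧ G.Adj s v ∧ u ≠ v ∧ Reach G {s, u} v t := by
  obtain ⟨v, hv, hvt⟩ := hG.exists_adj_reach hst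
  obtain ⟨u, hu, huv⟩ : ∃ u, G.Adj s u ∧ u ≠ v := by
    by_cases h : x = v
    · exact ⟨y, hy, fun h' => hxy (h.trans h'.symm)⟩
    · exact ⟨x, hx, h⟩
  rcases hvt.insert_or_insert huv.symm with h | h
  · exact ⟨u, v, hu, hv, huv, Set.pair_comm u s ▸ h⟩
  · exact ⟨v, u, hv, hu, huv.symm, Set.pair_comm v s ▸ h⟩

/-! ### Harmonic functions and price vectors -/

/-- The generator of the Markov chain with jump rates `b`, applied to a function `h`. The function
is harmonic at `x` if the value at `x` is zero. -/
def generator [Fintype V] (b : V → V → ℝ) (h : V → ℝ) (x : V) : ℝ :=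
  ∑ y, b x y * (h y - h x)

theorem state_nonneg {G : Digraph V} {b : V → V → ℝ} (hb : b ∈ states G) (x y : V) : 0 ≤ b x y := by
  by_cases hxy : G.Adj x y
  · exact ((hb x y).1 hxy).le
  · exact ((hb x y).2 hxy).ge

theorem exists_state (G : Digraph V) : ∃ b, b ∈ states G := by
  classical
  exact ⟨fun x y => if G.Adj x y then 1 else 0, fun x y =>
    ⟨fun hxy => by simp [hxy], fun hxy => by simp [hxy]⟩⟩

section

variable [Fintype V] {G : Digraph V} {b : V → V → ℝ} {h : V → ℝ} {D : Set V} {x y : V} {c : ℝ}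

theorem generator_neg (b : V → V → ℝ) (h : V → ℝ) (x : V) :
    generator b (-h) x = -generator b h x := by
  simp only [generator, ← Finset.sum_neg_distrib]
  exact Finset.sum_congr rfl fun y _ => by simp only [Pi.neg_apply]; ring

theorem eq_of_generator_eq_zero_of_le (hb : b ∈ states G) (hx : generator b h x = 0)
    (hle : ∀ y, h y ≤ h x) (hadj : G.Adj x y) : h y = h x := by
  have h1 := (Finset.sum_eq_zero_iff_of_nonpos fun y _ =>
    mul_nonpos_of_nonneg_of_nonpos (state_nonneg hb x y) (sub_nonpos.2 (hle y))).1 hx y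
      (Finset.mem_univ y)
  exact sub_eq_zero.1 ((mul_eq_zero.1 h1).resolve_left ((hb x y).1 hadj).ne')

theorem eq_of_generator_eq_zero_of_unique (hb : b ∈ states G) (hx : generator b h x = 0)
    (hadj : G.Adj x y) (huniq : ∀ z, G.Adj x z → z = y) : h x = h y := by
  have h1 : generator b h x = b x y * (h y - h x) := by
    refine Finset.sum_eq_single y (fun z _ hz => ?_) (by simp)
    rw [(hb x z).2 fun hxz => hz (huniq z hxz), zero_mul]
  rw [h1] at hx
  exact (sub_eq_zero.1 ((mul_eq_zero.1 hx).resolve_left ((hb x y).1 hadj).ne')).symm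

/-- Strong maximum principle: a function attaining its maximum at `x` attains it at every `y` that
a walk from `x` reaches without leaving the domain of harmonicity. -/
theorem Reach.eq_of_harmonic {S : Set V} (hxy : Reach G S x y) (hb : b ∈ states G)
    (hh : ∀ z ∉ D, generator b h z = 0) (hS : ∀ z ∈ D, z ∈ S ∨ z = y)
    (hle : ∀ z, h z ≤ c) (hx : h x = c) : h y = c := by
  induction hxy with
  | refl _ => exact hx
  | @step x z y hxS hadj _ ih =>
    by_cases hxD : x ∈ D
    · rcases hS x hxD with h1 | h1
      · exact absurd h1 hxS
      · exact h1 ▸ hx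
    · refine ih hS ?_
      rw [← hx]
      exact eq_of_generator_eq_zero_of_le hb (hh x hxD) (fun w => hx ▸ hle w) hadj

theorem le_of_harmonic (hG : IsConnected G) (hb : b ∈ states G)
    (hh : ∀ z ∉ D, generator b h z = 0) (hD : D.Nonempty) (hc : ∀ z ∈ D, h z ≤ c) (x : V) :
    h x ≤ c := by
  have : Nonempty V := ⟨x⟩
  obtain ⟨m, hm⟩ := Finite.exists_max h
  obtain ⟨d, hd⟩ := hD
  have key : ∀ u v, Reach G ∅ u v → v ∈ D → h u = h m → ∃ w ∈ D, h w = h m := by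
    intro u v huv hv hu
    induction huv with
    | @refl u _ => exact ⟨u, hv, hu⟩
    | @step u z v _ hadj _ ih =>
      by_cases huD : u ∈ D
      · exact ⟨u, huD, hu⟩
      · refine ih hv ?_
        rw [← hu]
        exact eq_of_generator_eq_zero_of_le hb (hh u huD) (fun w => hu ▸ hm w) hadj
  obtain ⟨w, hw, hwm⟩ := key m d (hG.reach m d) hd rfl
  exact (hm x).trans (hwm ▸ hc w hw)

theorem ge_of_harmonic (hG : IsConnected G) (hb : b ∈ states G)
    (hh : ∀ z ∉ D, generator b h z = 0) (hD : D.Nonempty) (hc : ∀ z ∈ D, c ≤ h z) (x : V) :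
    c ≤ h x := by
  have := le_of_harmonic (h := -h) (c := -c) hG hb
    (fun z hz => by rw [generator_neg, hh z hz, neg_zero]) hD
    (fun z hz => neg_le_neg (hc z hz)) x
  exact neg_le_neg_iff.1 this

/-- The Dirichlet problem is solvable, because by the maximum principle it has at most one
solution. -/
theorem exists_harmonic (hG : IsConnected G) (hb : b ∈ states G) (hD : D.Nonempty) (φ : V → ℝ) :
    ∃ h : V → ℝ, (∀ x ∈ D, h x = φ x) ∧ ∀ x ∉ D, generator b h x = 0 := by
  classical
  let T : (V → ℝ) →ₗ[ℝ] (V → ℝ) :=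
    { toFun := fun h x => if x ∈ D then h x else generator b h x
      map_add' := fun f g => by
        ext x
        by_cases hx : x ∈ D
        · simp [hx]
        · simp only [hx, if_false, Pi.add_apply, generator, ← Finset.sum_add_distrib]
          exact Finset.sum_congr rfl fun y _ => by ring
      map_smul' := fun a f => by
        ext x
        by_cases hx : x ∈ D
        · simp [hx]
        · simp only [hx, if_false, Pi.smul_apply, generator, smul_eq_mul, Finset.mul_sum,
            RingHom.id_apply]
          exact Finset.sum_congr rfl fun y _ => by ring }
  have hT : Function.Injective T := by
    rw [injective_iff_map_eq_zero]
    intro h h0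
    have h1 : ∀ x ∈ D, h x = 0 := fun x hx => by simpa [T, hx] using congrFun h0 x
    have h2 : ∀ x ∉ D, generator b h x = 0 := fun x hx => by simpa [T, hx] using congrFun h0 x
    ext x
    exact le_antisymm (le_of_harmonic hG hb h2 hD (fun z hz => (h1 z hz).le) x)
      (ge_of_harmonic hG hb h2 hD (fun z hz => (h1 z hz).ge) x)
  obtain ⟨h, hh⟩ := LinearMap.injective_iff_surjective.1 hT fun x => if x ∈ D then φ x else 0
  exact ⟨h, fun x hx => by simpa [T, hx] using congrFun hh x,
    fun x hx => by simpa [T, hx] using congrFun hh x⟩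

/-- Value conservation says that the generator has mean zero against the price vector. -/
theorem IsPriceVector.sum_mul_generator {p : V → ℝ} (hp : IsPriceVector b p) (h : V → ℝ) :
    ∑ x, p x * generator b h x = 0 := by
  have h1 : ∑ x, p x * generator b h x
      = (∑ y, h y * ∑ x, p x * b x y) - ∑ x, h x * ∑ y, p x * b x y := by
    simp only [generator, Finset.mul_sum]
    rw [Finset.sum_comm (f := fun y x => h y * (p x * b x y)), ← Finset.sum_sub_distrib]
    refine Finset.sum_congr rfl fun x _ => ?_
    rw [← Finset.sum_sub_distrib]
    exact Finset.sum_congr rfl fun y _ => by ring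
  rw [h1, ← Finset.sum_sub_distrib]
  exact Finset.sum_eq_zero fun x _ => by rw [hp.2 x, sub_self]

/-- The balance equations are singular because constants are harmonic; the absolute value of any
solution is again a solution, since the total inflow equals the total outflow, and it is positive
because positivity propagates along edges. -/
theorem exists_isPriceVector [Nonempty V] (hG : IsConnected G) (hb : b ∈ states G) :
    ∃ p, IsPriceVector b p := by
  classical
  let M : Matrix V V ℝ := fun x y => b x y - if x = y then ∑ z, b x z else 0
  obtain ⟨p, hp0, hp⟩ : ∃ p ≠ 0, Matrix.vecMul p M = 0 := by
    rw [Matrix.exists_vecMul_eq_zero_iff, ← Matrix.exists_mulVec_eq_zero_iff]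
    refine ⟨1, one_ne_zero, ?_⟩
    ext x
    simp [M, Matrix.mulVec, dotProduct, Finset.sum_sub_distrib]
  have hbal : ∀ y, ∑ x, p x * b x y = p y * ∑ z, b y z := fun y => by
    have := congrFun hp y
    simpa [M, Matrix.vecMul, dotProduct, mul_sub, Finset.sum_sub_distrib, sub_eq_zero] using this
  have hle : ∀ y ∈ Finset.univ, |p y| * ∑ z, b y z ≤ ∑ x, |p x| * b x y := fun y _ => by
    have hout : 0 ≤ ∑ z, b y z := Finset.sum_nonneg fun z _ => state_nonneg hb y z
    rw [← abs_of_nonneg hout, ← abs_mul, ← hbal y]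
    refine (Finset.abs_sum_le_sum_abs _ _).trans (Finset.sum_le_sum fun x _ => ?_)
    rw [abs_mul, abs_of_nonneg (state_nonneg hb x y)]
  have heq : ∀ y, |p y| * ∑ z, b y z = ∑ x, |p x| * b x y := fun y => by
    refine (Finset.sum_eq_sum_iff_of_le hle).1 ?_ y (Finset.mem_univ y)
    simp only [Finset.mul_sum]
    exact Finset.sum_comm
  have hstep : ∀ x y, G.Adj x y → p x ≠ 0 → p y ≠ 0 := by
    intro x y hxy hx hy
    have h1 : ∑ x, |p x| * b x y = 0 := by rw [← heq y, hy]; simp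
    have h2 := (Finset.sum_eq_zero_iff_of_nonneg fun x _ =>
      mul_nonneg (abs_nonneg (p x)) (state_nonneg hb x y)).1 h1 x (Finset.mem_univ x)
    exact (mul_pos (abs_pos.2 hx) ((hb x y).1 hxy)).ne' h2
  obtain ⟨x, hx⟩ := Function.ne_iff.1 hp0
  have hpos : ∀ u v, Reach G ∅ u v → p u ≠ 0 → p v ≠ 0 := by
    intro u v huv hu
    induction huv with
    | refl _ => exact hu
    | step _ hadj _ ih => exact ih (hstep _ _ hadj hu)
  exact ⟨fun y => |p y|, fun y => abs_pos.2 (hpos x y (hG.reach x y) hx),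
    fun y => by rw [← Finset.mul_sum]; exact (heq y).symm⟩

theorem isPriceVector_price [Nonempty V] (hG : IsConnected G) (hb : b ∈ states G) :
    IsPriceVector b (price b) :=
  Classical.epsilon_spec (exists_isPriceVector hG hb)

end

/-! ### Influential edges -/

section

variable [Fintype V] {G : Digraph V} {b b' : V → V → ℝ} {h : V → ℝ} {i j k l : V}

/-- The effect of changing one component of the state, measured against a function `h`. -/
theorem IsPriceVector.sum_mul_generator_of_change {p' : V → ℝ} (hp' : IsPriceVector b' p')
    (hbb : ∀ x y, (x, y) ≠ (k, l) → b x y = b' x y) (h : V → ℝ) :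
    ∑ x, p' x * generator b h x = p' k * ((b k l - b' k l) * (h l - h k)) := by
  have h1 := hp'.sum_mul_generator h
  have h2 : ∑ x, p' x * generator b h x
      = ∑ x, p' x * generator b h x - ∑ x, p' x * generator b' h x := by rw [h1, sub_zero]
  have h3 : ∀ x, generator b h x - generator b' h x = ∑ y, (b x y - b' x y) * (h y - h x) := by
    intro x
    rw [generator, generator, ← Finset.sum_sub_distrib]
    exact Finset.sum_congr rfl fun y _ => by ring
  rw [h2, ← Finset.sum_sub_distrib]
  simp only [← mul_sub, h3]
  rw [Finset.sum_eq_single k, Finset.sum_eq_single l]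
  · intro y _ hy
    rw [hbb k y (by simp [hy]), sub_self, zero_mul]
  · simp
  · intro x _ hx
    rw [Finset.sum_eq_zero, mul_zero]
    intro y _
    rw [hbb x y (by simp [hx]), sub_self, zero_mul]
  · simp

theorem sum_mul_generator_eq_add (hij : i ≠ j)
    (hh : ∀ x ∉ ({i, j} : Set V), generator b h x = 0) (p : V → ℝ) :
    ∑ x, p x * generator b h x = p i * generator b h i + p j * generator b h j := by
  classical
  rw [← Finset.sum_pair (f := fun x => p x * generator b h x) hij]
  refine (Finset.sum_subset (Finset.subset_univ _) fun x _ hx => ?_).symm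
  rw [hh x (by simpa using hx), mul_zero]

theorem isInfluential_swap (h : IsInfluential G (priceRatio i j) (k, l)) :
    IsInfluential G (priceRatio j i) (k, l) := by
  obtain ⟨b, hb, b', hb', hbb, hne⟩ := h
  refine ⟨b, hb, b', hb', hbb, fun he => hne ?_⟩
  have := congrArg (·⁻¹) he
  simpa [priceRatio] using this

/-- An edge is influential as soon as some function harmonic off `{i, j}` at some state takes
different values at its ends. -/
theorem isInfluential_of_harmonic (hG : IsConnected G) (hij : i ≠ j) (hkl : G.Adj k l)
    (hb : b ∈ states G) (hh : ∀ x ∉ ({i, j} : Set V), generator b h x = 0) (hne : h k ≠ h l) :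
    IsInfluential G (priceRatio i j) (k, l) := by
  classical
  have : Nonempty V := ⟨i⟩
  let b' : V → V → ℝ := fun x y => if (x, y) = (k, l) then b x y + 1 else b x y
  have hbb : ∀ x y, (x, y) ≠ (k, l) → b x y = b' x y := fun x y hxy => by
    simp only [b', hxy, if_false]
  have hb' : b' ∈ states G := by
    intro x y
    by_cases hxy : (x, y) = (k, l)
    · obtain ⟨rfl, rfl⟩ := Prod.mk.inj hxy
      exact ⟨fun _ => by simpa [b'] using add_pos ((hb x y).1 hkl) one_pos, fun h => absurd hkl h⟩
    · rw [← hbb x y hxy]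
      exact hb x y
  refine ⟨b, hb, b', hb', hbb, fun he => hne ?_⟩
  have hp := isPriceVector_price hG hb
  have hp' := isPriceVector_price hG hb'
  have h1 := hp.sum_mul_generator h
  have h2 := hp'.sum_mul_generator_of_change hbb h
  rw [sum_mul_generator_eq_add hij hh] at h1 h2
  have hpj := (hp.1 j).ne'
  have hpj' := (hp'.1 j).ne'
  rw [priceRatio, priceRatio, div_eq_div_iff hpj hpj'] at he
  have hkl' : b k l - b' k l = -1 := by simp [b']
  rw [hkl'] at h2
  have h3 : price b j * (price b' k * (-1 * (h l - h k))) = 0 := by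
    rw [← h2]
    linear_combination (-generator b h i) * he + price b' j * h1
  have h4 := (mul_eq_zero.1 ((mul_eq_zero.1 h3).resolve_left hpj)).resolve_left (hp'.1 k).ne'
  linarith

/-- Conversely, across an influential edge a nonconstant function harmonic off `{i, j}` takes
different values at some state. -/
theorem IsInfluential.exists_harmonic (hG : IsConnected G) (hij : i ≠ j)
    (hinf : IsInfluential G (priceRatio i j) (k, l)) :
    G.Adj k l ∧ ∃ b ∈ states G, ∃ h : V → ℝ,
      (∀ x ∉ ({i, j} : Set V), generator b h x = 0) ∧ h k ≠ h l := by
  have : Nonempty V := ⟨i⟩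
  obtain ⟨b, hb, b', hb', hbb, hne⟩ := hinf
  refine ⟨?_, b, hb, ?_⟩
  · by_contra hkl
    refine hne (congrArg _ ?_)
    ext x y
    by_cases hxy : (x, y) = (k, l)
    · obtain ⟨rfl, rfl⟩ := Prod.mk.inj hxy
      rw [(hb x y).2 hkl, (hb' x y).2 hkl]
    · exact hbb x y hxy
  classical
  obtain ⟨h, hφ, hh⟩ := PriceComplexity.exists_harmonic hG hb (D := {i, j}) ⟨i, by simp⟩
    fun x => if x = i then 1 else 0
  have hi : h i = 1 := by simpa using hφ i (by simp)
  have hj : h j = 0 := by simpa [hij.symm] using hφ j (by simp)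
  refine ⟨h, hh, fun hkl => hne ?_⟩
  have hp := isPriceVector_price hG hb
  have hp' := isPriceVector_price hG hb'
  have h1 := hp.sum_mul_generator h
  have h2 := hp'.sum_mul_generator_of_change hbb h
  rw [hkl, sub_self, mul_zero, mul_zero] at h2
  rw [sum_mul_generator_eq_add hij hh] at h1 h2
  have hpj := (hp.1 j).ne'
  have hpj' := (hp'.1 j).ne'
  have hA : generator b h i ≠ 0 := by
    intro hA
    -- `h` would be harmonic off `j` alone, hence at most `h j = 0`.
    have := le_of_harmonic (h := h) (D := {j}) (c := 0) hG hb (fun x hx => ?_) ⟨j, rfl⟩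
      (by simp [hj]) i
    · linarith
    · by_cases hxi : x = i
      · rwa [hxi]
      · exact hh x (by simpa [hxi] using hx)
  rw [priceRatio, priceRatio, div_eq_div_iff hpj hpj']
  refine mul_right_cancel₀ hA ?_
  linear_combination price b' j * h1 - price b j * h2

/-- The probability of hitting `i` before `j`. -/
theorem exists_hitting (hG : IsConnected G) (hb : b ∈ states G) (hij : i ≠ j) :
    ∃ h : V → ℝ, h i = 1 ∧ h j = 0 ∧ (∀ x, 0 ≤ h x) ∧ (∀ x, h x ≤ 1) ∧
      ∀ x ∉ ({i, j} : Set V), generator b h x = 0 := by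
  classical
  obtain ⟨h, hφ, hh⟩ := exists_harmonic hG hb (D := {i, j}) ⟨i, by simp⟩
    fun x => if x = i then 1 else 0
  have hi : h i = 1 := by simpa using hφ i (by simp)
  have hj : h j = 0 := by simpa [hij.symm] using hφ j (by simp)
  exact ⟨h, hi, hj, ge_of_harmonic hG hb hh ⟨i, by simp⟩ (by simp [hi, hj]),
    le_of_harmonic hG hb hh ⟨i, by simp⟩ (by simp [hi, hj]), hh⟩

/-- From `k` the chain may hit `j` before `i`, so the hitting probability of `i` is less than one
at `k`. -/
theorem isInfluential_of_adj_left (hG : IsConnected G) (hki : G.Adj k i) (hkj : Reach G {i} k j) :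
    IsInfluential G (priceRatio i j) (k, i) := by
  have hij : i ≠ j := fun h => hkj.right_notMem h.symm
  obtain ⟨b, hb⟩ := exists_state G
  obtain ⟨h, hi, hj, -, h1, hh⟩ := exists_hitting hG hb hij
  refine isInfluential_of_harmonic hG hij hki hb hh fun hk => ?_
  have := hkj.eq_of_harmonic hb hh (by simp) h1 (hk.trans hi)
  linarith

/-- From `l` the chain may hit `j` before `i`, so the hitting probability of `i` is less than one
at `l`. -/
theorem isInfluential_of_left_adj (hG : IsConnected G) (hil : G.Adj i l) (hlj : Reach G {i} l j) :
    IsInfluential G (priceRatio i j) (i, l) := by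
  have hij : i ≠ j := fun h => hlj.right_notMem h.symm
  obtain ⟨b, hb⟩ := exists_state G
  obtain ⟨h, hi, hj, -, h1, hh⟩ := exists_hitting hG hb hij
  refine isInfluential_of_harmonic hG hij hil hb hh fun hl => ?_
  have := hlj.eq_of_harmonic hb hh (by simp) h1 (hl.symm.trans hi)
  linarith

theorem exists_isInfluential_left (hG : IsConnected G) (hij : i ≠ j) :
    ∃ l, IsInfluential G (priceRatio i j) (i, l) := by
  obtain ⟨l, hil, hlj⟩ := hG.exists_adj_reach hij
  exact ⟨l, isInfluential_of_left_adj hG hil hlj⟩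

/-- At a fork, with one edge to `i` and the other on a way to `j`, give the first edge a large
weight. Then the hitting probability of `i` is close to one at `k`, whereas at `l` it is bounded
away from one by the probability of hitting `j` before `k` and `i`, which does not depend on the
weights of the edges out of `k`. -/
theorem isInfluential_of_fork (hG : IsConnected G) (hki : G.Adj k i) (hkl : G.Adj k l)
    (hlj : Reach G {k, i} l j) (hik : i ≠ k) :
    IsInfluential G (priceRatio i j) (k, l) := by
  classical
  have hij : i ≠ j := fun h => hlj.right_notMem (by simp [h])
  have hkj : k ≠ j := fun h => hlj.right_notMem (by simp [h])
  obtain ⟨b, hb⟩ := exists_state G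
  have hDg : ({k, i, j} : Set V).Nonempty := ⟨i, by simp⟩
  obtain ⟨g, hφ, hg⟩ := exists_harmonic hG hb hDg fun x => if x = j then 0 else 1
  have hgk : g k = 1 := by simpa [hkj] using hφ k (by simp)
  have hgi : g i = 1 := by simpa [hij] using hφ i (by simp)
  have hgj : g j = 0 := by simpa using hφ j (by simp)
  have hg1 : ∀ x, g x ≤ 1 := le_of_harmonic hG hb hg hDg (by simp [hgk, hgi, hgj])
  have hgl : g l < 1 := by
    refine (hg1 l).lt_of_ne fun hl => ?_
    have := hlj.eq_of_harmonic hb hg (by simp) hg1 hl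
    linarith
  -- With weight `M` on `ki` and total weight `R` on the other edges out of `k`, the hitting
  -- probability at `k` is at least `M / (M + R)`.
  set R : ℝ := ∑ y ∈ Finset.univ.erase i, b k y with hR
  have hR0 : 0 ≤ R := Finset.sum_nonneg fun y _ => state_nonneg hb k y
  obtain ⟨M, hM0, hM⟩ : ∃ M : ℝ, 0 < M ∧ R * g l < M * (1 - g l) := by
    have h1 : 0 < 1 - g l := sub_pos.2 hgl
    refine ⟨(|R * g l| + 1) / (1 - g l), by positivity, ?_⟩
    rw [div_mul_cancel₀ _ h1.ne']
    linarith [le_abs_self (R * g l)]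
  let b' : V → V → ℝ := fun x y => if (x, y) = (k, i) then M else b x y
  have hbb : ∀ x y, (x, y) ≠ (k, i) → b' x y = b x y := fun x y hxy => by
    simp only [b', hxy, if_false]
  have hb' : b' ∈ states G := by
    intro x y
    by_cases hxy : (x, y) = (k, i)
    · obtain ⟨rfl, rfl⟩ := Prod.mk.inj hxy
      exact ⟨fun _ => by simpa [b'] using hM0, fun h => absurd hki h⟩
    · rw [hbb x y hxy]
      exact hb x y
  obtain ⟨h, hi, hj, h0, h1, hh⟩ := exists_hitting hG hb' hij
  refine isInfluential_of_harmonic hG hij hkl hb' hh fun hkl' => ?_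
  -- Comparison of `h` and `g` on the complement of `{k, i, j}`.
  have hle : h l ≤ g l := by
    have hd : ∀ x ∉ ({k, i, j} : Set V), generator b (h - g) x = 0 := by
      intro x hx
      have e1 : generator b' h x = generator b h x :=
        Finset.sum_congr rfl fun y _ => by rw [hbb x y (by rintro ⟨⟩; simp at hx)]
      have e2 : generator b (h - g) x = generator b h x - generator b g x := by
        simp only [generator, ← Finset.sum_sub_distrib]
        exact Finset.sum_congr rfl fun y _ => by simp only [Pi.sub_apply]; ring
      rw [e2, hg x hx, ← e1, hh x (fun hx' => hx (Set.mem_insert_of_mem _ hx')), sub_zero]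
    have := le_of_harmonic (c := 0) hG hb hd hDg (by simp [hgk, hgi, hgj, hi, hj, h1]) l
    simpa using this
  have hk := hh k (by simp [hik.symm, hkj])
  rw [generator, ← Finset.add_sum_erase _ _ (Finset.mem_univ i)] at hk
  have hsum : -(R * h k) ≤ ∑ y ∈ Finset.univ.erase i, b' k y * (h y - h k) := by
    rw [hR, Finset.sum_mul, ← Finset.sum_neg_distrib]
    refine Finset.sum_le_sum fun y hy => ?_
    rw [hbb k y (by simp [Finset.ne_of_mem_erase hy])]
    nlinarith [mul_nonneg (state_nonneg hb k y) (h0 y)]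
  have hbki : b' k i = M := by simp [b']
  rw [hbki, hi] at hk
  nlinarith [mul_le_mul_of_nonneg_left (hkl'.trans_le hle) hR0,
    mul_le_mul_of_nonneg_left (hkl'.trans_le hle) hM0.le]

/-! ### Lower bounds -/

theorem card_le_pairPriceComplexity {s : Finset (V × V)}
    (hs : ∀ e ∈ s, IsInfluential G (priceRatio i j) e) : s.card ≤ pairPriceComplexity G i j := by
  rw [pairPriceComplexity, ← Set.ncard_coe_finset]
  exact Set.ncard_le_ncard (fun e he => hs e he) (Set.toFinite _)

variable [DecidableEq V]

theorem pairPriceComplexity_le_priceComplexity (hij : i ≠ j) :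
    pairPriceComplexity G i j ≤ priceComplexity G :=
  Finset.le_sup (f := fun e : V × V => pairPriceComplexity G e.1 e.2)
    (b := (i, j)) (by simp [hij])

theorem card_le_priceComplexity (hij : i ≠ j) {s : Finset (V × V)}
    (hs : ∀ e ∈ s, IsInfluential G (priceRatio i j) e) : s.card ≤ priceComplexity G :=
  (card_le_pairPriceComplexity hs).trans (pairPriceComplexity_le_priceComplexity hij)

theorem two_le_priceComplexity (hG : IsConnected G) (hij : i ≠ j) : 2 ≤ priceComplexity G := by
  obtain ⟨k, hk⟩ := exists_isInfluential_left hG hij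
  obtain ⟨l, hl⟩ := exists_isInfluential_left hG hij.symm
  refine le_of_eq_of_le ?_ (card_le_priceComplexity (s := {(i, k), (j, l)}) hij ?_)
  · simp [hij]
  · simp only [Finset.mem_insert, Finset.mem_singleton]
    rintro e (rfl | rfl)
    exacts [hk, isInfluential_swap hl]

variable {s t u v w x y z : V}

/-- Compare the prices at the heads of two edges out of the same vertex. -/
theorem four_le_priceComplexity (hs : IsSimple G) (hG : IsConnected G) (hu : G.Adj s u)
    (hv : G.Adj s v) (huv : u ≠ v) : 4 ≤ priceComplexity G := by
  have hsu : s ≠ u := hs.ne_of_adj hu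
  have hsv : s ≠ v := hs.ne_of_adj hv
  obtain ⟨k, hk⟩ := exists_isInfluential_left hG huv
  obtain ⟨l, hl⟩ := exists_isInfluential_left hG huv.symm
  refine le_of_eq_of_le ?_
    (card_le_priceComplexity (s := {(s, u), (s, v), (u, k), (v, l)}) huv ?_)
  · simp [huv, hsu, hsv]
  · simp only [Finset.mem_insert, Finset.mem_singleton]
    rintro e (rfl | rfl | rfl | rfl)
    · exact isInfluential_of_adj_left hG hu (.step (by simp [hsu]) hv (.refl (by simp [huv.symm])))
    · exact isInfluential_swap
        (isInfluential_of_adj_left hG hv (.step (by simp [hsv]) hu (.refl (by simp [huv]))))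
    · exact hk
    · exact isInfluential_swap hl

/-- Two vertices of outdegree at least two, `s` with edges to `u` and towards `t`, and `t` with
edges to `x` and towards `s`, give five influential edges: for the pair `u`, `x` if these differ,
and for the pair `u`, `t` otherwise. -/
theorem five_le_priceComplexity_of_two_forks (hs : IsSimple G) (hG : IsConnected G) (hst : s ≠ t)
    (hsx : ∃ x y, G.Adj s x ∧ G.Adj s y ∧ x ≠ y) (htx : ∃ x y, G.Adj t x ∧ G.Adj t y ∧ x ≠ y) :
    5 ≤ priceComplexity G := by
  obtain ⟨_, _, h1, h2, h3⟩ := hsx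
  obtain ⟨u, v, hu, hv, huv, hvt⟩ := hG.exists_adj_reach_insert hst h1 h2 h3
  obtain ⟨_, _, h1, h2, h3⟩ := htx
  obtain ⟨x, y, hx, hy, hxy, hys⟩ := hG.exists_adj_reach_insert hst.symm h1 h2 h3
  have hsu : s ≠ u := hs.ne_of_adj hu
  have htx : t ≠ x := hs.ne_of_adj hx
  have htu : t ≠ u := fun h => hvt.right_notMem (by simp [h])
  have hsx : s ≠ x := fun h => hys.right_notMem (by simp [h])
  have hst' : Reach G {u} s t := .step (by simp [hsu]) hv (hvt.mono (by simp))
  have hts' : Reach G {x} t s := .step (by simp [htx]) hy (hys.mono (by simp))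
  by_cases hux : u = x
  · subst hux
    obtain ⟨k, hk⟩ := exists_isInfluential_left hG htu.symm
    refine le_of_eq_of_le ?_ (card_le_priceComplexity
      (s := {(s, u), (s, v), (t, u), (t, y), (u, k)}) htu.symm ?_)
    · simp [huv, hxy, hst, hsu, htu]
    · simp only [Finset.mem_insert, Finset.mem_singleton]
      rintro e (rfl | rfl | rfl | rfl | rfl)
      · exact isInfluential_of_adj_left hG hu hst'
      · exact isInfluential_of_fork hG hu hv hvt hsu.symm
      · exact isInfluential_of_adj_left hG hx (.refl (by simp [htu]))
      · exact isInfluential_swap (isInfluential_of_left_adj hG hy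
          ((hys.mono (by simp)).tail hu (by simp [htu.symm])))
      · exact hk
  · have hxu : x ≠ u := Ne.symm hux
    obtain ⟨k, hk⟩ := exists_isInfluential_left hG hux
    refine le_of_eq_of_le ?_ (card_le_priceComplexity
      (s := {(s, u), (s, v), (t, x), (t, y), (u, k)}) hux ?_)
    · simp [huv, hxy, hst, hsu, htu]
    · simp only [Finset.mem_insert, Finset.mem_singleton]
      rintro e (rfl | rfl | rfl | rfl | rfl)
      · exact isInfluential_of_adj_left hG hu (hst'.tail hx (by simp [hxu]))
      · exact isInfluential_of_fork hG hu hv (hvt.tail hx (by simp [hxu, hsx.symm])) hsu.symm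
      · exact isInfluential_swap
          (isInfluential_of_adj_left hG hx (hts'.tail hu (by simp [hux])))
      · exact isInfluential_swap
          (isInfluential_of_fork hG hx hy (hys.tail hu (by simp [hux, htu.symm])) htx.symm)
      · exact hk

/-- Three edges out of `s`, two of which lead to `z` avoiding the head `u` of the third, are all
influential for the pair `u`, `z`. -/
theorem five_le_priceComplexity_of_reach_insert (hs : IsSimple G) (hG : IsConnected G)
    (hu : G.Adj s u) (hv : G.Adj s v) (hw : G.Adj s w) (huv : u ≠ v) (huw : u ≠ w) (hvw : v ≠ w)
    (hvz : Reach G {s, u} v z) (hwz : Reach G {s, u} w z) : 5 ≤ priceComplexity G := by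
  have hsu : s ≠ u := hs.ne_of_adj hu
  have huz : u ≠ z := fun h => hvz.right_notMem (by simp [h])
  have hsz : s ≠ z := fun h => hvz.right_notMem (by simp [h])
  obtain ⟨k, hk⟩ := exists_isInfluential_left hG huz
  obtain ⟨l, hl⟩ := exists_isInfluential_left hG huz.symm
  refine le_of_eq_of_le ?_ (card_le_priceComplexity
    (s := {(s, u), (s, v), (s, w), (u, k), (z, l)}) huz ?_)
  · simp [huv, huw, hvw, hsu, hsz, huz]
  · simp only [Finset.mem_insert, Finset.mem_singleton]
    rintro e (rfl | rfl | rfl | rfl | rfl)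
    · exact isInfluential_of_adj_left hG hu (.step (by simp [hsu]) hv (hvz.mono (by simp)))
    · exact isInfluential_of_fork hG hu hv hvz hsu.symm
    · exact isInfluential_of_fork hG hu hw hwz hsu.symm
    · exact hk
    · exact isInfluential_swap hl

/-- Three edges out of `s`, two of which lead to a common vertex without returning to `s`. -/
theorem five_le_priceComplexity_of_merge (hs : IsSimple G) (hG : IsConnected G)
    (hu : G.Adj s u) (hv : G.Adj s v) (hw : G.Adj s w) (huv : u ≠ v) (huw : u ≠ w) (hvw : v ≠ w)
    (huz : Reach G {s} u z) (hvz : Reach G {s} v z) : 5 ≤ priceComplexity G := by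
  -- If the third head `w` is met on the way from `u`, it takes the place of `z`, and one of `u` and
  -- `v` can be avoided on the way from the other to `w`.
  have key : ∀ {u v : V}, G.Adj s u → G.Adj s v → u ≠ v → u ≠ w → v ≠ w → Reach G {s} u w →
      5 ≤ priceComplexity G := by
    intro u v hu hv huv huw hvw h
    have hws : s ≠ w := hs.ne_of_adj hw
    rcases h.insert_or v with h1 | h1
    · rw [Set.pair_comm] at h1
      exact five_le_priceComplexity_of_reach_insert hs hG hv hu hw huv.symm hvw huw h1
        (.refl (by simp [hws.symm, hvw.symm]))
    rcases h.insert_or_insert huv with h2 | h2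
    · rw [Set.pair_comm] at h2
      exact five_le_priceComplexity_of_reach_insert hs hG hv hu hw huv.symm hvw huw h2
        (.refl (by simp [hws.symm, hvw.symm]))
    · rw [Set.pair_comm] at h2
      exact five_le_priceComplexity_of_reach_insert hs hG hu hv hw huv huw hvw h2
        (.refl (by simp [hws.symm, huw.symm]))
  rcases huz.insert_or w with h1 | h1
  · rcases hvz.insert_or w with h2 | h2
    · rw [Set.pair_comm] at h1 h2
      exact five_le_priceComplexity_of_reach_insert hs hG hw hu hv huw.symm hvw.symm huv h1 h2
    · exact key hv hu huv.symm hvw huw h2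
  · exact key hu hv huv huw hvw h1

end

/-! ### Upper bounds -/

section

variable [Fintype V] {G : Digraph V} {i j s : V} {e : V × V} {n : ℕ}

theorem exists_adj_ne_of_isInfluential (hG : IsConnected G) (hij : i ≠ j)
    (he : IsInfluential G (priceRatio i j) e) (hi : e.1 ≠ i) (hj : e.1 ≠ j) :
    ∃ z, G.Adj e.1 z ∧ z ≠ e.2 := by
  obtain ⟨hadj, b, hb, h, hh, hne⟩ := IsInfluential.exists_harmonic hG hij he
  by_contra! hz
  exact hne (eq_of_generator_eq_zero_of_unique hb (hh e.1 (by simp [hi, hj])) hadj hz)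

theorem IsInfluential.adj (hG : IsConnected G) (hij : i ≠ j)
    (he : IsInfluential G (priceRatio i j) e) : G.Adj e.1 e.2 :=
  (IsInfluential.exists_harmonic hG hij he).1

/-- A harmonic function is constant along a path through vertices of outdegree one. -/
theorem IsPath.eq_of_harmonic {b : V → V → ℝ} (hb : b ∈ states G) {h : V → ℝ} {x y : V}
    {l : List V} (hl : IsPath G x y l) (hh : ∀ v ∈ x :: l, generator b h v = 0)
    (huniq : ∀ v ∈ x :: l, ∀ y z, G.Adj v y → G.Adj v z → y = z) : h x = h y := by
  induction l generalizing x with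
  | nil =>
    have hadj : G.Adj x y := hl.adj (x, y) (by simp [pathEdges])
    exact eq_of_generator_eq_zero_of_unique hb (hh x (by simp)) hadj
      fun z hz => huniq x (by simp) z y hz hadj
  | cons v l ih =>
    rw [← ih hl.tail (fun w hw => hh w (List.mem_cons_of_mem _ hw))
      fun w hw => huniq w (List.mem_cons_of_mem _ hw)]
    exact eq_of_generator_eq_zero_of_unique hb (hh x (by simp)) hl.adj_head
      fun z hz => huniq x (by simp) z v hz hl.adj_head

theorem ncard_setOf_fst_eq_le_one {p : Prop} (x : V)
    (h : p → ∀ y z, G.Adj x y → G.Adj x z → y = z) :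
    {e : V × V | e.1 = x ∧ p ∧ G.Adj e.1 e.2}.ncard ≤ 1 := by
  rw [Set.ncard_le_one (Set.toFinite _)]
  rintro ⟨_, y⟩ ⟨rfl, hp, hy⟩ ⟨_, z⟩ ⟨rfl, -, hz⟩
  rw [h hp y z hy hz]

variable [DecidableEq V]

theorem priceComplexity_le (h : ∀ i j, i ≠ j → pairPriceComplexity G i j ≤ n) :
    priceComplexity G ≤ n :=
  Finset.sup_le fun e he => h e.1 e.2 (by simpa using he)

theorem priceComplexity_le_two (hG : IsConnected G)
    (huniq : ∀ x y z, G.Adj x y → G.Adj x z → y = z) : priceComplexity G ≤ 2 := by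
  refine priceComplexity_le fun i j hij => ?_
  have hsub : {e | IsInfluential G (priceRatio i j) e} ⊆
      {e | e.1 = i ∧ True ∧ G.Adj e.1 e.2} ∪ {e | e.1 = j ∧ True ∧ G.Adj e.1 e.2} := by
    intro e he
    have hadj := IsInfluential.adj hG hij he
    by_contra h
    simp only [Set.mem_union, Set.mem_ofPred_eq, hadj, and_true, not_or] at h
    obtain ⟨z, hz, hne⟩ := exists_adj_ne_of_isInfluential hG hij he h.1 h.2
    exact hne (huniq e.1 z e.2 hz hadj)
  refine (Set.ncard_le_ncard hsub (Set.toFinite _)).trans ((Set.ncard_union_le _ _).trans ?_)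
  have h1 := ncard_setOf_fst_eq_le_one (p := True) i fun _ => huniq i
  have h2 := ncard_setOf_fst_eq_le_one (p := True) j fun _ => huniq j
  omega

/-- If only `s` has outdegree greater than one, and it has outdegree two, then at most the edges out
of `i`, `j` and `s` are influential. -/
theorem priceComplexity_le_four_of_unique (hG : IsConnected G)
    (huniq : ∀ x, x ≠ s → ∀ y z, G.Adj x y → G.Adj x z → y = z) (u v : V)
    (huv : ∀ w, G.Adj s w → w = u ∨ w = v) : priceComplexity G ≤ 4 := by
  refine priceComplexity_le fun i j hij => ?_
  have hsub : {e | IsInfluential G (priceRatio i j) e} ⊆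
      ({e | e.1 = i ∧ i ≠ s ∧ G.Adj e.1 e.2} ∪ {e | e.1 = j ∧ j ≠ s ∧ G.Adj e.1 e.2}) ∪
        {(s, u), (s, v)} := by
    rintro ⟨k, l⟩ he
    have hadj : G.Adj k l := IsInfluential.adj hG hij he
    by_cases hk : k = s
    · subst hk
      rcases huv l hadj with rfl | rfl <;> simp
    · by_contra h
      simp only [Set.mem_union, Set.mem_ofPred_eq, hadj, and_true, not_or] at h
      obtain ⟨z, hz, hne⟩ := exists_adj_ne_of_isInfluential hG hij he
        (fun hi => h.1.1 ⟨hi, hi ▸ hk⟩) (fun hj => h.1.2 ⟨hj, hj ▸ hk⟩)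
      exact hne (huniq k hk z l hz hadj)
  have h1 := ncard_setOf_fst_eq_le_one (p := i ≠ s) i fun h => huniq i h
  have h2 := ncard_setOf_fst_eq_le_one (p := j ≠ s) j fun h => huniq j h
  have h3 := Set.ncard_insert_le (s, u) {(s, v)}
  rw [Set.ncard_singleton] at h3
  have h4 := Set.ncard_union_le
    ({e : V × V | e.1 = i ∧ i ≠ s ∧ G.Adj e.1 e.2} ∪ {e | e.1 = j ∧ j ≠ s ∧ G.Adj e.1 e.2})
    {(s, u), (s, v)}
  have h5 := Set.ncard_union_le {e : V × V | e.1 = i ∧ i ≠ s ∧ G.Adj e.1 e.2}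
    {e : V × V | e.1 = j ∧ j ≠ s ∧ G.Adj e.1 e.2}
  have h6 := Set.ncard_le_ncard hsub (Set.toFinite _)
  rw [pairPriceComplexity]
  omega

/-- In a rose with centre `s`, besides the edges out of `i` and `j` at most the first edges of the
cycles through `i` and through `j` are influential: harmonic functions are constant on every other
cycle. -/
theorem IsRose.priceComplexity_le_four (hs : IsSimple G) (hG : IsConnected G) {k : ℕ}
    (hrose : IsRose k G) : priceComplexity G ≤ 4 := by
  obtain ⟨s, C, hC, hdisj, -, hadj⟩ := hrose
  have huniq : ∀ x, x ≠ s → ∀ y z, G.Adj x y → G.Adj x z → y = z := by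
    intro x hx y z hy hz
    obtain ⟨t, ht⟩ := (hadj x y).1 hy
    obtain ⟨t', ht'⟩ := (hadj x z).1 hz
    have h1 := (List.mem_cons.1 (mem_of_mem_pathEdges ht)).resolve_left hx
    have h2 := (List.mem_cons.1 (mem_of_mem_pathEdges ht')).resolve_left hx
    obtain rfl : t = t' := by
      by_contra hne
      exact hdisj t t' hne h1 h2
    exact pathEdges_right_unique (hC t).nodup_cons ht ht'
  refine priceComplexity_le fun i j hij => ?_
  let W : V → Set (V × V) := fun x => {e | e.1 = s ∧ ∃ t, x ∈ C t ∧ e ∈ pathEdges s s (C t)}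
  have hW : ∀ x, (W x).ncard ≤ 1 := by
    intro x
    rw [Set.ncard_le_one (Set.toFinite _)]
    rintro ⟨_, y⟩ ⟨rfl, t, hxt, hy⟩ ⟨_, z⟩ ⟨rfl, t', hxt', hz⟩
    obtain rfl : t = t' := by
      by_contra hne
      exact hdisj t t' hne hxt hxt'
    rw [pathEdges_right_unique (hC t).nodup_cons hy hz]
  have hsub : {e | IsInfluential G (priceRatio i j) e} ⊆
      ({e | e.1 = i ∧ i ≠ s ∧ G.Adj e.1 e.2} ∪ {e | e.1 = j ∧ j ≠ s ∧ G.Adj e.1 e.2}) ∪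
        (W i ∪ W j) := by
    rintro ⟨k, l⟩ he
    have hkl : G.Adj k l := IsInfluential.adj hG hij he
    by_contra h
    simp only [Set.mem_union, Set.mem_ofPred_eq, hkl, and_true, not_or] at h
    by_cases hk : k = s
    · subst hk
      obtain ⟨-, b, hb, f, hf, hne⟩ := IsInfluential.exists_harmonic hG hij he
      obtain ⟨t, ht⟩ := (hadj k l).1 hkl
      have hit : i ∉ C t := fun hi => h.2.1 ⟨rfl, t, hi, ht⟩
      have hjt : j ∉ C t := fun hj => h.2.2 ⟨rfl, t, hj, ht⟩
      have hCt := hC t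
      cases hc : C t with
      | nil =>
        rw [hc] at ht
        obtain rfl : l = k := by simpa [pathEdges] using ht
        exact hs _ hkl
      | cons v c =>
        rw [hc] at ht hit hjt hCt
        obtain rfl : l = v :=
          pathEdges_right_unique hCt.nodup_cons ht (by simp [pathEdges_cons])
        refine hne (IsPath.eq_of_harmonic hb hCt.tail (fun w hw => hf w ?_) fun w hw =>
          huniq w ?_).symm
        · simp only [Set.mem_insert_iff, Set.mem_singleton_iff, not_or]
          exact ⟨fun h => hit (h ▸ hw), fun h => hjt (h ▸ hw)⟩
        · rintro rfl
          exact hCt.left_notMem hw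
    · obtain ⟨z, hz, hne⟩ := exists_adj_ne_of_isInfluential hG hij he
        (fun hi => h.1.1 ⟨hi, hi ▸ hk⟩) (fun hj => h.1.2 ⟨hj, hj ▸ hk⟩)
      exact hne (huniq k hk z l hz hkl)
  have h1 := ncard_setOf_fst_eq_le_one (p := i ≠ s) i fun h => huniq i h
  have h2 := ncard_setOf_fst_eq_le_one (p := j ≠ s) j fun h => huniq j h
  have h3 := Set.ncard_union_le (W i) (W j)
  have h4 := Set.ncard_union_le
    ({e : V × V | e.1 = i ∧ i ≠ s ∧ G.Adj e.1 e.2} ∪ {e | e.1 = j ∧ j ≠ s ∧ G.Adj e.1 e.2})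
    (W i ∪ W j)
  have h5 := Set.ncard_union_le {e : V × V | e.1 = i ∧ i ≠ s ∧ G.Adj e.1 e.2}
    {e : V × V | e.1 = j ∧ j ≠ s ∧ G.Adj e.1 e.2}
  have h6 := Set.ncard_le_ncard hsub (Set.toFinite _)
  have h7 := hW i
  have h8 := hW j
  rw [pairPriceComplexity]
  omega

/-! ### Roses and chorded cycles -/

theorem priceComplexity_eq_zero_of_isRose_zero (h : IsRose 0 G) : priceComplexity G = 0 := by
  obtain ⟨s, C, -, -, hV, -⟩ := h
  have hv : ∀ v, v = s := fun v => (hV v).resolve_right fun ⟨t, _⟩ => t.elim0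
  exact Nat.le_zero.1 (priceComplexity_le fun i j hij => absurd ((hv i).trans (hv j).symm) hij)

theorem priceComplexity_eq_two_of_isRose_one (hs : IsSimple G) (hG : IsConnected G)
    (h : IsRose 1 G) : priceComplexity G = 2 := by
  obtain ⟨s, C, hC, -, -, hadj⟩ := h
  have huniq : ∀ x y z, G.Adj x y → G.Adj x z → y = z := by
    intro x y z hy hz
    obtain ⟨t, ht⟩ := (hadj x y).1 hy
    obtain ⟨t', ht'⟩ := (hadj x z).1 hz
    exact pathEdges_right_unique (hC t).nodup_cons ht (Subsingleton.elim t' t ▸ ht')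
  obtain ⟨x, hx, -⟩ := exists_mem_pathEdges s (List.mem_cons_self (a := s) (l := C 0))
  have hsx : G.Adj s x := (hC 0).adj _ hx
  have hne : s ≠ x := hs.ne_of_adj hsx
  exact le_antisymm (priceComplexity_le_two hG huniq) (two_le_priceComplexity hG hne)

theorem priceComplexity_eq_four_of_isRose (hs : IsSimple G) (hG : IsConnected G) {k : ℕ}
    (hk : 2 ≤ k) (h : IsRose k G) : priceComplexity G = 4 := by
  refine le_antisymm (h.priceComplexity_le_four hs hG) ?_
  obtain ⟨s, C, hC, hdisj, -, -⟩ := h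
  have hfirst : ∀ t, ∃ x ∈ C t, G.Adj s x := by
    intro t
    obtain ⟨x, hx, hx'⟩ := exists_mem_pathEdges s (List.mem_cons_self (a := s) (l := C t))
    have hsx : G.Adj s x := (hC t).adj _ hx
    exact ⟨x, hx'.resolve_right (hs.ne_of_adj hsx).symm, hsx⟩
  obtain ⟨u, hu, hsu⟩ := hfirst ⟨0, by omega⟩
  obtain ⟨v, hv, hsv⟩ := hfirst ⟨1, by omega⟩
  refine four_le_priceComplexity hs hG hsu hsv ?_
  rintro rfl
  exact hdisj _ _ (by simp) hu hv

theorem priceComplexity_eq_four_of_isChordedCycle (hs : IsSimple G) (hG : IsConnected G)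
    (h : IsChordedCycle G) : priceComplexity G = 4 := by
  obtain ⟨i, x, c, p, hc, hx, hp, hcp, hedge, -, hadj⟩ := h
  obtain ⟨u, hu, -⟩ := exists_mem_pathEdges i (List.mem_cons_self (a := i) (l := c))
  obtain ⟨v, hv, -⟩ := exists_mem_pathEdges x (List.mem_cons_self (a := i) (l := p))
  have huv : u ≠ v := by
    intro h
    exact hedge hu (h ▸ hv)
  refine le_antisymm (priceComplexity_le_four_of_unique (s := i) hG ?_ u v ?_)
    (four_le_priceComplexity hs hG (hc.adj (i, u) hu) (hp.adj (i, v) hv) huv)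
  · intro w hw y z hy hz
    rcases (hadj w y).1 hy with hy | hy <;> rcases (hadj w z).1 hz with hz | hz
    · exact pathEdges_right_unique hc.nodup_cons hy hz
    · exact absurd ((List.mem_cons.1 (mem_of_mem_pathEdges hz)).resolve_left hw)
        (hcp ((List.mem_cons.1 (mem_of_mem_pathEdges hy)).resolve_left hw))
    · exact absurd ((List.mem_cons.1 (mem_of_mem_pathEdges hy)).resolve_left hw)
        (hcp ((List.mem_cons.1 (mem_of_mem_pathEdges hz)).resolve_left hw))
    · exact pathEdges_right_unique hp.nodup_cons hy hz
  · intro w hw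
    rcases (hadj i w).1 hw with h | h
    · exact .inl (pathEdges_right_unique hc.nodup_cons h hu)
    · exact .inr (pathEdges_right_unique hp.nodup_cons h hv)

end

/-! ### Graphs with at most one vertex of outdegree greater than one -/

section

variable {G : Digraph V} {s : V}

/-- Split a list at its first element satisfying a predicate. -/
theorem exists_append_cons_of_mem {P : V → Prop} {l : List V} {x : V} (hx : x ∈ l) (hPx : P x) :
    ∃ p z r, l = p ++ z :: r ∧ P z ∧ ∀ y ∈ p, ¬ P y := by
  induction l with
  | nil => simp at hx
  | cons v l ih =>
    by_cases hv : P v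
    · exact ⟨[], v, l, rfl, hv, by simp⟩
    · obtain ⟨p, z, r, rfl, hz, hp⟩ :=
        ih ((List.mem_cons.1 hx).resolve_left (by rintro rfl; exact hv hPx))
      exact ⟨v :: p, z, r, rfl, hz, by simpa [hv] using hp⟩

theorem IsPath.mem_pathEdges_of_adj {i j x y : V} {l : List V} (hl : IsPath G i j l)
    (hx : x ∈ i :: l) (huniq : ∀ y z, G.Adj x y → G.Adj x z → y = z) (hxy : G.Adj x y) :
    (x, y) ∈ pathEdges i j l ∧ (y ∈ l ∨ y = j) := by
  obtain ⟨z, hz, hz'⟩ := exists_mem_pathEdges j hx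
  obtain rfl := huniq y z hxy (hl.adj _ hz)
  exact ⟨hz, hz'⟩

/-- If all vertices other than `s` have outdegree one, then the cycles through the edges out of `s`
cover the graph. -/
theorem eq_or_exists_mem_of_unique (hG : IsConnected G)
    (huniq : ∀ x, x ≠ s → ∀ y z, G.Adj x y → G.Adj x z → y = z) {C : {u // G.Adj s u} → List V}
    (hC : ∀ u : {u // G.Adj s u}, IsPath G u s (C u)) (v : V) :
    v = s ∨ ∃ u : {u // G.Adj s u}, v ∈ u.1 :: C u := by
  have key : ∀ x y, Reach G ∅ x y → (x = s ∨ ∃ u : {u // G.Adj s u}, x ∈ u.1 :: C u) →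
      y = s ∨ ∃ u : {u // G.Adj s u}, y ∈ u.1 :: C u := by
    intro x y hxy hx
    induction hxy with
    | refl _ => exact hx
    | @step x z y _ hadj _ ih =>
      refine ih ?_
      by_cases hxs : x = s
      · subst hxs
        exact .inr ⟨⟨z, hadj⟩, by simp⟩
      · obtain ⟨u, hu⟩ := hx.resolve_left hxs
        rcases ((hC u).mem_pathEdges_of_adj hu (huniq x hxs) hadj).2 with h | h
        · exact .inr ⟨u, List.mem_cons_of_mem _ h⟩
        · exact .inl h
  exact key s v (hG.reach s v) (.inl rfl)

theorem isRose_of_pairwise_disjoint [Finite V] (hs : IsSimple G) (hG : IsConnected G)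
    (huniq : ∀ x, x ≠ s → ∀ y z, G.Adj x y → G.Adj x z → y = z) {C : {u // G.Adj s u} → List V}
    (hC : ∀ u : {u // G.Adj s u}, IsPath G u s (C u))
    (hdisj : ∀ u v : {u // G.Adj s u}, u ≠ v → (u.1 :: C u).Disjoint (v.1 :: C v)) :
    ∃ k, IsRose k G := by
  obtain ⟨k, ⟨e⟩⟩ := Finite.exists_equiv_fin {u // G.Adj s u}
  have hC' : ∀ u : {u // G.Adj s u}, IsCycleAt G s (u.1 :: C u) := fun u => by
    have hne : s ≠ u.1 := hs.ne_of_adj u.2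
    exact (hC u).cons u.2 (by simp [hne, (hC u).right_notMem]) hne
  refine ⟨k, s, fun t => (e.symm t).1 :: C (e.symm t), fun t => hC' _, fun t t' h => hdisj _ _
    (by simpa using h), fun v => ?_, fun x y => ⟨fun hxy => ?_, fun ⟨t, ht⟩ => (hC' _).adj _ ht⟩⟩
  · refine (eq_or_exists_mem_of_unique hG huniq hC v).imp_right ?_
    rintro ⟨u, hu⟩
    exact ⟨e u, by simpa using hu⟩
  · by_cases hx : x = s
    · subst hx
      exact ⟨e ⟨y, hxy⟩, by simp [pathEdges_cons]⟩
    · obtain ⟨u, hu⟩ := (eq_or_exists_mem_of_unique hG huniq hC x).resolve_left hx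
      have := ((hC u).mem_pathEdges_of_adj hu (huniq x hx) hxy).1
      exact ⟨e u, by simp [pathEdges_cons, this]⟩

/-- Two cycles through `s` that meet elsewhere form a chorded cycle: the chord is the second cycle
up to the first vertex `z` on the first one, and from `z` on the two cycles agree. -/
theorem isChordedCycle_of_merge (hs : IsSimple G) (hG : IsConnected G)
    (huniq : ∀ x, x ≠ s → ∀ y z, G.Adj x y → G.Adj x z → y = z) {C : {u // G.Adj s u} → List V}
    (hC : ∀ u : {u // G.Adj s u}, IsPath G u s (C u)) {u v : {u // G.Adj s u}} (huv : u ≠ v)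
    (hall : ∀ w, w = u ∨ w = v) {x : V} (hxu : x ∈ u.1 :: C u) (hxv : x ∈ v.1 :: C v) :
    IsChordedCycle G := by
  have hC' : ∀ u : {u // G.Adj s u}, IsCycleAt G s (u.1 :: C u) := fun u => by
    have hne : s ≠ u.1 := hs.ne_of_adj u.2
    exact (hC u).cons u.2 (by simp [hne, (hC u).right_notMem]) hne
  have hcov := eq_or_exists_mem_of_unique hG huniq hC
  obtain ⟨p, z, r, hpr, hz, hp⟩ := exists_append_cons_of_mem (P := (· ∈ u.1 :: C u)) hxv hxu
  have hv := hC' v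
  rw [hpr] at hv
  have hzs : IsPath G s z p := IsPath.left_of_append hv
  have hps : s ∉ p := hzs.left_notMem
  have hcs : s ∉ u.1 :: C u := (hC' u).left_notMem
  have hsv : (s, v.1) ∈ pathEdges s z p := by
    cases p with
    | nil =>
      obtain ⟨rfl, -⟩ := List.cons.inj hpr
      simp [pathEdges]
    | cons w p =>
      obtain ⟨rfl, -⟩ := List.cons.inj hpr
      simp [pathEdges_cons]
  -- After `z`, the second cycle stays on the first one.
  have hr : ∀ y ∈ r, y ∈ u.1 :: C u := by
    have key : ∀ x y, Reach G {s} x y → x ∈ u.1 :: C u → y ∈ u.1 :: C u := by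
      intro x y hxy hx
      induction hxy with
      | refl _ => exact hx
      | @step x w y hxs hadj hwy ih =>
        refine ih ?_
        rcases ((hC u).mem_pathEdges_of_adj hx (huniq x hxs) hadj).2 with h | h
        · exact List.mem_cons_of_mem _ h
        · exact absurd h hwy.left_notMem
    have hzr : IsPath G z s r :=
      { adj := fun e he => hv.adj e (by rw [pathEdges_append]; exact List.mem_append_right _ he)
        nodup := (List.nodup_cons.1 (List.nodup_append.1 hv.nodup).2.1).2
        left_notMem := (List.nodup_cons.1 (List.nodup_append.1 hv.nodup).2.1).1
        right_notMem := fun h => hv.right_notMem (by simp [h]) }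
    intro y hy
    refine key z y (hzr.reach_mem (fun w hw => ?_) (List.mem_cons_of_mem _ hy)) hz
    rintro rfl
    exact hv.right_notMem (List.mem_append_right _ hw)
  have hV : ∀ y, y = s ∨ y ∈ u.1 :: C u ∨ y ∈ p := by
    intro y
    refine (hcov y).imp_right ?_
    rintro ⟨w, hw⟩
    rcases hall w with rfl | rfl
    · exact .inl hw
    · rw [hpr, List.mem_append, List.mem_cons] at hw
      rcases hw with hw | rfl | hw
      exacts [.inr hw, .inl hz, .inl (hr y hw)]
  refine ⟨s, z, u.1 :: C u, p, hC' u, hz, hzs, fun y hy hyp => hp y hyp hy, ?_, hV, ?_⟩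
  · rintro ⟨y, w⟩ h1 h2
    rcases List.mem_cons.1 (mem_of_mem_pathEdges h2) with rfl | hy
    · have e1 : w = v.1 := pathEdges_right_unique hzs.nodup_cons h2 hsv
      have e2 : w = u.1 :=
        pathEdges_right_unique (hC' u).nodup_cons h1 (by simp [pathEdges_cons])
      exact huv (Subtype.ext (e2.symm.trans e1))
    · rcases List.mem_cons.1 (mem_of_mem_pathEdges h1) with rfl | hy'
      · exact hps hy
      · exact hp y hy hy'
  · intro y w
    refine ⟨fun hyw => ?_, fun h => h.elim ((hC' u).adj _) (hzs.adj _)⟩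
    by_cases hys : y = s
    · subst hys
      rcases hall ⟨w, hyw⟩ with h | h
      · exact .inl (by simp [pathEdges_cons, ← h])
      · rw [← h] at hsv
        exact .inr hsv
    · rcases (hV y).resolve_left hys with hy | hy
      · exact .inl ((hC' u).mem_pathEdges_of_adj (List.mem_cons_of_mem _ hy) (huniq y hys) hyw).1
      · exact .inr (hzs.mem_pathEdges_of_adj (List.mem_cons_of_mem _ hy) (huniq y hys) hyw).1

theorem isRose_or_isChordedCycle_or_five_le [Fintype V] [DecidableEq V] (hs : IsSimple G)
    (hG : IsConnected G) (huniq : ∀ x, x ≠ s → ∀ y z, G.Adj x y → G.Adj x z → y = z) :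
    (∃ k, IsRose k G) ∨ IsChordedCycle G ∨ 5 ≤ priceComplexity G := by
  have hex : ∀ u : {u // G.Adj s u}, ∃ l, IsPath G u s l := fun u =>
    hG u s (hs.ne_of_adj u.2).symm
  choose C hC using hex
  by_cases hdisj : ∀ u v : {u // G.Adj s u}, u ≠ v → (u.1 :: C u).Disjoint (v.1 :: C v)
  · exact .inl (isRose_of_pairwise_disjoint hs hG huniq hC hdisj)
  right
  push Not at hdisj
  obtain ⟨u, v, huv, hnd⟩ := hdisj
  obtain ⟨x, hxu, hxv⟩ : ∃ x, x ∈ u.1 :: C u ∧ x ∈ v.1 :: C v := by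
    by_contra! h
    exact hnd fun x h1 h2 => h x h1 h2
  by_cases hall : ∀ w, w = u ∨ w = v
  · exact .inl (isChordedCycle_of_merge hs hG huniq hC huv hall hxu hxv)
  · push Not at hall
    obtain ⟨w, hwu, hwv⟩ := hall
    have hreach : ∀ u : {u // G.Adj s u}, x ∈ u.1 :: C u → Reach G {s} u x := by
      intro u hx
      refine (hC u).reach_mem (fun y hy => ?_) hx
      rintro rfl
      rcases List.mem_cons.1 hy with h | h
      · exact hs.ne_of_adj u.2 h
      · exact (hC u).right_notMem h
    exact .inr (five_le_priceComplexity_of_merge hs hG u.2 v.2 w.2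
      (fun h => huv (Subtype.ext h)) (fun h => hwu (Subtype.ext h).symm)
      (fun h => hwv (Subtype.ext h).symm) (hreach u hxu) (hreach v hxv))

theorem five_le_priceComplexity [Fintype V] [DecidableEq V] [Nonempty V] (hs : IsSimple G)
    (hG : IsConnected G) (hchord : ¬ IsChordedCycle G) (hrose : ¬ ∃ k, IsRose k G) :
    5 ≤ priceComplexity G := by
  by_cases h : ∃ s, ∀ x, x ≠ s → ∀ y z, G.Adj x y → G.Adj x z → y = z
  · obtain ⟨s, huniq⟩ := h
    exact ((isRose_or_isChordedCycle_or_five_le hs hG huniq).resolve_left hrose).resolve_left hchord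
  · push Not at h
    obtain ⟨s, -, hsx⟩ := h (Classical.arbitrary V)
    obtain ⟨t, hts, htx⟩ := h s
    obtain ⟨x, y, hx, hy, hxy⟩ := hsx
    obtain ⟨x', y', hx', hy', hxy'⟩ := htx
    exact five_le_priceComplexity_of_two_forks hs hG hts.symm ⟨x, y, hx, hy, hxy⟩
      ⟨x', y', hx', hy', hxy'⟩

end

end PriceComplexity

theorem mainTheorem3 {V : Type*} [Fintype V] [DecidableEq V] [Nonempty V] (G : Digraph V)
    (hsimple : PriceComplexity.IsSimple G) (hconn : PriceComplexity.IsConnected G) :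
    ((¬ PriceComplexity.IsChordedCycle G ∧ ¬ ∃ k, PriceComplexity.IsRose k G) →
        5 ≤ PriceComplexity.priceComplexity G) ∧
    (PriceComplexity.IsRose 0 G → PriceComplexity.priceComplexity G = 0) ∧
    (PriceComplexity.IsRose 1 G → PriceComplexity.priceComplexity G = 2) ∧
    (PriceComplexity.IsChordedCycle G → PriceComplexity.priceComplexity G = 4) ∧
    (∀ k, 2 ≤ k → PriceComplexity.IsRose k G → PriceComplexity.priceComplexity G = 4) ∧
    (PriceComplexity.priceComplexity G ≤ 4 ↔
      PriceComplexity.IsChordedCycle G ∨ ∃ k, PriceComplexity.IsRose k G) := by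
  have hchord := PriceComplexity.priceComplexity_eq_four_of_isChordedCycle hsimple hconn
  have hfive := PriceComplexity.five_le_priceComplexity hsimple hconn
  refine ⟨fun h => hfive h.1 h.2, PriceComplexity.priceComplexity_eq_zero_of_isRose_zero,
    PriceComplexity.priceComplexity_eq_two_of_isRose_one hsimple hconn, hchord,
    fun k hk => PriceComplexity.priceComplexity_eq_four_of_isRose hsimple hconn hk,
    fun h => ?_, ?_⟩
  · by_contra! hne
    have := hfive hne.1 fun ⟨k, hk⟩ => hne.2 k hk
    omega
  · rintro (h | ⟨k, h⟩)
    · exact (hchord h).le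
    · exact h.priceComplexity_le_four hsimple hconn
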